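/- Let $\mathcal H$ be a finite-dimensional complex Hilbert space, $P$ an orthogonal projection on $\mathcal H$, and $Q=I-P$. Let $\rho$ be a density matrix on $\mathcal H$, and put $A=P\rho P$, $B=P\rho Q$, $C=Q\rho Q$, $\Pi\rho=P\rho P+Q\rho Q$, $M=\Pi\rho$, $Y=\rho-\Pi\rho$ and $\varepsilon_Q=\operatorname{Tr}C$. Assume that $M>0$ (positive definite). Let $\Gamma>0$ and consider the dephasing orbit $\rho_t=M+e^{-\Gamma t}Y$, $t\ge 0$ (the orbit of $\rho$ under the semigroup generated by $\mathcal L(\sigma)=-\Gamma(P\sigma Q+Q\sigma P)$). Let $D(\rho\|\sigma)=\operatorname{Tr}[\rho(\log\rho-\log\sigma)]$ be the relative entropy, with $0\log 0=0$, and let $\|\cdot\|_F$ be the Frobenius norm. Suppose that $a_0\in\mathbb R$ satisfies $A\ge a_0P$ and $\varepsilon_Q\le a_0/2$. Then for all $t\ge 0$ $$-\frac{d}{dt}D(\rho_t\|\Pi\rho)\;\ge\;2\Gamma e^{-2\Gamma t}\,\|B\|_F^2\,\log\!\Bigl(\frac{a_0}{\varepsilon_Q}\Bigr).$$ Here $t\mapsto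 D(\rho_t\|\Pi\rho)$ is differentiable at every $t>0$. At $t=0$ the derivative is the right derivative, which exists in $[-\infty,+\infty]$ and is finite if $\rho>0$. The right-hand side is read as $0$ in the degenerate case $Q=0$, where $B=0$ and $\varepsilon_Q=0$. -/

import Mathlib

open scoped Matrix ComplexOrder

noncomputable section

namespace Dephasing

variable {ι : Type*} [Fintype ι] [DecidableEq ι]

/-- Density matrices: positive semidefinite complex matrices of trace one. -/
def IsDensityMatrix (ρ : Matrix ι ι ℂ) : Prop :=
  ρ.PosSemidef ∧ ρ.trace = 1

/-- `P` is (the matrix of) an orthogonal projection. -/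
def IsOrthProj (P : Matrix ι ι ℂ) : Prop :=
  P.IsHermitian ∧ P * P = P

/-- The diagonal block `A = P ρ P`, as an operator on the whole space. -/
def blockA (P ρ : Matrix ι ι ℂ) : Matrix ι ι ℂ := P * ρ * P

/-- The off-diagonal (coherence) block `B = P ρ Q`, where `Q = 1 - P`. -/
def blockB (P ρ : Matrix ι ι ℂ) : Matrix ι ι ℂ := P * ρ * (1 - P)

/-- The diagonal block `C = Q ρ Q`, where `Q = 1 - P`. -/
def blockC (P ρ : Matrix ι ι ℂ) : Matrix ι ι ℂ := (1 - P) * ρ * (1 - P)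

/-- The block-diagonal pinching `Π ρ = P ρ P + Q ρ Q`. -/
def pinching (P ρ : Matrix ι ι ℂ) : Matrix ι ι ℂ := blockA P ρ + blockC P ρ

/-- The dephasing generator `σ ↦ -Γ (P σ Q + Q σ P)`. -/
def generator (Γ : ℝ) (P σ : Matrix ι ι ℂ) : Matrix ι ι ℂ :=
  (-Γ) • (P * σ * (1 - P) + (1 - P) * σ * P)

/-- The dephasing orbit `ρ_t = M + e^{-Γ t} Y` with `M = Π ρ` and `Y = ρ - Π ρ`. -/
def orbit (Γ : ℝ) (P ρ : Matrix ι ι ℂ) (t : ℝ) : Matrix ι ι ℂ :=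
  pinching P ρ + Real.exp (-Γ * t) • (ρ - pinching P ρ)

/-- The orbit solves the linear equation given by the generator (entrywise, which is the same as
in any matrix norm) and starts at `ρ`. -/
theorem orbit_spec (Γ : ℝ) (P ρ : Matrix ι ι ℂ) (hP : IsOrthProj P) :
    orbit Γ P ρ 0 = ρ ∧
    ∀ (t : ℝ) (i j : ι),
      HasDerivAt (fun s => orbit Γ P ρ s i j) (generator Γ P (orbit Γ P ρ t) i j) t := by
  refine ⟨by simp [orbit], fun t i j => ?_⟩
  have h2 := hP.2
  have hQ : (1 - P) * (1 - P) = 1 - P := by rw [mul_sub, sub_mul, sub_mul]; simp [h2]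
  have hPQ : P * (1 - P) = 0 := by rw [mul_sub]; simp [h2]
  have hQP : (1 - P) * P = 0 := by rw [sub_mul]; simp [h2]
  have hY : ρ - pinching P ρ = P * ρ * (1 - P) + (1 - P) * ρ * P := by
    simp only [pinching, blockA, blockC]; noncomm_ring
  have h1 : P * pinching P ρ * (1 - P) = 0 := by
    simp only [pinching, blockA, blockC, mul_add, add_mul]
    simp only [mul_assoc, hPQ, mul_zero, zero_add]
    rw [← mul_assoc, hPQ, zero_mul]
  have h1' : (1 - P) * pinching P ρ * P = 0 := by
    simp only [pinching, blockA, blockC, mul_add, add_mul]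
    simp only [mul_assoc, hQP, mul_zero, add_zero]
    rw [← mul_assoc, hQP, zero_mul]
  have hg : generator Γ P (orbit Γ P ρ t) =
      (-Γ * Real.exp (-Γ * t)) • (ρ - pinching P ρ) := by
    rw [generator, orbit]
    have e1 : P * (pinching P ρ + Real.exp (-Γ * t) • (ρ - pinching P ρ)) * (1 - P)
        = Real.exp (-Γ * t) • (P * ρ * (1 - P)) := by
      rw [mul_add, add_mul, h1, mul_smul_comm, smul_mul_assoc, mul_sub P, sub_mul _ _ (1 - P), h1]
      simp
    have e2 : (1 - P) * (pinching P ρ + Real.exp (-Γ * t) • (ρ - pinching P ρ)) * P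
        = Real.exp (-Γ * t) • ((1 - P) * ρ * P) := by
      rw [mul_add, add_mul, h1', mul_smul_comm, smul_mul_assoc, mul_sub (1 - P), sub_mul _ _ P, h1']
      simp
    rw [e1, e2, ← smul_add, ← hY, smul_smul]
  rw [hg]
  have hd : HasDerivAt (fun s : ℝ => Real.exp (-Γ * s)) (-Γ * Real.exp (-Γ * t)) t := by
    have := ((hasDerivAt_id t).const_mul (-Γ)).exp
    simpa [mul_comm] using this
  have := (hd.smul_const ((ρ - pinching P ρ) i j)).const_add (pinching P ρ i j)
  simpa [orbit] using this

/-- The logarithm of a Hermitian matrix by functional calculus (with the value `0` on the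
kernel, so that `ρ * logm ρ` follows the convention `0 log 0 = 0`). -/
def logm (ρ : Matrix ι ι ℂ) : Matrix ι ι ℂ := cfc Real.log ρ

/-- Umegaki relative entropy `D(ρ‖σ) = Tr[ρ (log ρ - log σ)]` of a positive semidefinite `ρ`
with respect to a positive definite `σ`; it is finite, hence real valued, for these arguments,
and it is used only for them. -/
def relEntropy (ρ σ : Matrix ι ι ℂ) : ℝ := (ρ * (logm ρ - logm σ)).trace.re

/-- The square of the Frobenius norm. -/
def frobSq (B : Matrix ι ι ℂ) : ℝ := ∑ i, ∑ j, ‖B i j‖ ^ 2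

/-- The leakage `ε_Q = Tr C`. -/
def leakage (P ρ : Matrix ι ι ℂ) : ℝ := (blockC P ρ).trace.re

/-- The function `t ↦ D(ρ_t‖Π ρ)` along the dephasing orbit. -/
def orbitEntropy (Γ : ℝ) (P ρ : Matrix ι ι ℂ) (t : ℝ) : ℝ :=
  relEntropy (orbit Γ P ρ t) (pinching P ρ)

end Dephasing

end

noncomputable section

namespace Dephasing

open Matrix Filter Topology

/-! ### Functional calculus in an eigenbasis and Klein's inequality. -/

section Spectral

variable {n : Type*} [Fintype n] [DecidableEq n]

/-! Put s = e^{-Γt}, Z_s = M + sY. Since Tr[Y log M] = 0, the relative entropy is Tr[Z_s log Z_s]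
minus a constant, and its time derivative is -Γ s Tr[Y log Z_s]. It remains to show Tr[Y log Z_s] ≥
2s‖B‖² log(a₀/ε) (`le_segmentSlope`).

The logarithm is an integral of resolvents, so the core is a lower bound for -Tr[Y (Z_s + r)⁻¹]
(`trace_resolvent_le`). For the grading P - Q, M is even and Y is odd: odd traces vanish, and the
tangent bound for the inverse leaves a quadratic term in Y. Bounding each diagonal block by its
trace gives 2s‖B‖² / ((1-ε+r)(ε+r)), whose integral over r is logarithmic
(`log_bound_of_resolvent_bound`).

Klein's inequality makes Tr[Y log Z_s] a subgradient. With continuity this yields the derivative; it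
also makes difference quotients at t = 0 monotone, so the right derivative exists even for singular
ρ. -/

theorem cfc_eq_conj_diagonal {A : Matrix n n ℂ} (hA : A.IsHermitian) (f : ℝ → ℝ) :
    cfc f A = (hA.eigenvectorUnitary : Matrix n n ℂ) *
      diagonal (fun i => ((f (hA.eigenvalues i) : ℝ) : ℂ)) *
      (hA.eigenvectorUnitary : Matrix n n ℂ)ᴴ := by
  rw [hA.cfc_eq, IsHermitian.cfc, Unitary.conjStarAlgAut_apply]
  rfl

theorem eigenvectorUnitary_conjTranspose_mul {A : Matrix n n ℂ} (hA : A.IsHermitian) :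
    (hA.eigenvectorUnitary : Matrix n n ℂ)ᴴ * (hA.eigenvectorUnitary : Matrix n n ℂ) = 1 :=
  Unitary.coe_star_mul_self hA.eigenvectorUnitary

theorem eigenvectorUnitary_mul_conjTranspose {A : Matrix n n ℂ} (hA : A.IsHermitian) :
    (hA.eigenvectorUnitary : Matrix n n ℂ) * (hA.eigenvectorUnitary : Matrix n n ℂ)ᴴ = 1 :=
  Unitary.coe_mul_star_self hA.eigenvectorUnitary

theorem cfc_mul_cfc {A : Matrix n n ℂ} (hA : A.IsHermitian) (f g : ℝ → ℝ) :
    cfc f A * cfc g A = cfc (fun x => f x * g x) A := by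
  simp only [cfc_eq_conj_diagonal hA]
  set U := (hA.eigenvectorUnitary : Matrix n n ℂ)
  calc U * diagonal (fun i => ((f (hA.eigenvalues i) : ℝ) : ℂ)) * Uᴴ *
        (U * diagonal (fun i => ((g (hA.eigenvalues i) : ℝ) : ℂ)) * Uᴴ)
      = U * diagonal (fun i => ((f (hA.eigenvalues i) : ℝ) : ℂ)) * (Uᴴ * U) *
        diagonal (fun i => ((g (hA.eigenvalues i) : ℝ) : ℂ)) * Uᴴ := by simp only [mul_assoc]
    _ = _ := by
      rw [eigenvectorUnitary_conjTranspose_mul, mul_one, mul_assoc U, diagonal_mul_diagonal]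
      simp only [Complex.ofReal_mul]

theorem trace_mul_cfc_re {A : Matrix n n ℂ} (hA : A.IsHermitian) (X : Matrix n n ℂ) (f : ℝ → ℝ) :
    (X * cfc f A).trace.re = ∑ i, f (hA.eigenvalues i) *
      (((hA.eigenvectorUnitary : Matrix n n ℂ)ᴴ * X *
        (hA.eigenvectorUnitary : Matrix n n ℂ)) i i).re := by
  rw [cfc_eq_conj_diagonal hA]
  set U := (hA.eigenvectorUnitary : Matrix n n ℂ)
  rw [← mul_assoc, ← mul_assoc, trace_mul_comm, ← mul_assoc, ← mul_assoc, trace]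
  simp [mul_diagonal, mul_comm]

theorem trace_cfc_mul_cfc_re {A B : Matrix n n ℂ} (hA : A.IsHermitian) (hB : B.IsHermitian)
    (f g : ℝ → ℝ) :
    (cfc f A * cfc g B).trace.re = ∑ j, ∑ i, f (hA.eigenvalues i) * g (hB.eigenvalues j) *
      Complex.normSq (((hA.eigenvectorUnitary : Matrix n n ℂ)ᴴ *
        (hB.eigenvectorUnitary : Matrix n n ℂ)) i j) := by
  rw [trace_mul_cfc_re hB, cfc_eq_conj_diagonal hA]
  set U := (hA.eigenvectorUnitary : Matrix n n ℂ)
  set V := (hB.eigenvectorUnitary : Matrix n n ℂ)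
  have h : ∀ D : Matrix n n ℂ, Vᴴ * (U * D * Uᴴ) * V = (Uᴴ * V)ᴴ * D * (Uᴴ * V) := fun D => by
    simp only [conjTranspose_mul, conjTranspose_conjTranspose, mul_assoc]
  refine Finset.sum_congr rfl fun j _ => ?_
  rw [h, mul_apply, Complex.re_sum, Finset.mul_sum]
  refine Finset.sum_congr rfl fun i _ => ?_
  rw [mul_diagonal, conjTranspose_apply, Complex.normSq_apply]
  simp
  ring

/-- Klein's inequality for the function `x log x`. -/
theorem klein_inequality {X Z : Matrix n n ℂ} (hX : X.PosSemidef) (hZ : Z.PosDef) :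
    X.trace.re - Z.trace.re ≤ (X * logm X).trace.re - (X * logm Z).trace.re := by
  have hXs : IsSelfAdjoint X := hX.1
  have hZs : IsSelfAdjoint Z := hZ.1
  -- Padding with `cfc` of the constant 1 gives all four traces the same weights |⟨uᵢ, vⱼ⟩|²,
  -- reducing the claim to scalars.
  have e1 : X * logm X = cfc (fun x => x * Real.log x) X * cfc (fun _ => (1 : ℝ)) Z := by
    rw [cfc_const_one ℝ Z, mul_one, ← cfc_mul_cfc hX.1 (fun x => x) Real.log, cfc_id' ℝ X, logm]
  have e2 : X * logm Z = cfc (fun x : ℝ => x) X * cfc Real.log Z := by rw [cfc_id' ℝ X, logm]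
  have e3 : X = cfc (fun x : ℝ => x) X * cfc (fun _ => (1 : ℝ)) Z := by
    rw [cfc_const_one ℝ Z, mul_one, cfc_id' ℝ X]
  have e4 : Z = cfc (fun _ => (1 : ℝ)) X * cfc (fun x : ℝ => x) Z := by
    rw [cfc_const_one ℝ X, one_mul, cfc_id' ℝ Z]
  have t1 := congrArg (fun T => T.trace.re) e1
  have t2 := congrArg (fun T => T.trace.re) e2
  have t3 := congrArg (fun T => T.trace.re) e3
  have t4 := congrArg (fun T => T.trace.re) e4
  simp only [trace_cfc_mul_cfc_re hX.1 hZ.1] at t1 t2 t3 t4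
  rw [t1, t2, t3, t4]
  simp only [← Finset.sum_sub_distrib]
  refine Finset.sum_le_sum fun j _ => Finset.sum_le_sum fun i _ => ?_
  rw [← sub_mul, ← sub_mul]
  refine mul_le_mul_of_nonneg_right ?_ (Complex.normSq_nonneg _)
  have hx : 0 ≤ hX.1.eigenvalues i := hX.eigenvalues_nonneg i
  have hz : 0 < hZ.1.eigenvalues j := hZ.eigenvalues_pos j
  generalize hX.1.eigenvalues i = x at hx
  generalize hZ.1.eigenvalues j = z at hz
  rcases hx.eq_or_lt with rfl | hx
  · simp [hz.le]
  · have h := Real.log_le_sub_one_of_pos (div_pos hz hx)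
    rw [Real.log_div hz.ne' hx.ne'] at h
    have h2 := mul_le_mul_of_nonneg_left h hx.le
    have h3 : x * (z / x - 1) = z - x := by field_simp
    rw [h3] at h2
    nlinarith

theorem add_smul_one_inv_eq_cfc {X : Matrix n n ℂ} (hX : X.PosDef) {r : ℝ} (hr : 0 ≤ r) :
    (X + r • (1 : Matrix n n ℂ))⁻¹ = cfc (fun x => (x + r)⁻¹) X := by
  have hXs : IsSelfAdjoint X := hX.1
  have e : X + r • (1 : Matrix n n ℂ) = cfc (fun x => x + r) X := by
    rw [cfc_eq_conj_diagonal hX.1]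
    have h1 : X = _ := (cfc_id' ℝ X).symm.trans (cfc_eq_conj_diagonal hX.1 _)
    have h2 : diagonal (fun i => (((hX.1.eigenvalues i + r : ℝ)) : ℂ)) =
        diagonal (fun i => ((hX.1.eigenvalues i : ℝ) : ℂ)) + r • (1 : Matrix n n ℂ) := by
      ext i j
      by_cases h : i = j <;> simp [h, one_apply]
    rw [h2, mul_add, add_mul, ← h1, mul_smul_comm, smul_mul_assoc, mul_one,
      eigenvectorUnitary_mul_conjTranspose]
  refine inv_eq_right_inv ?_
  rw [e, cfc_mul_cfc hX.1, ← cfc_const_one ℝ X, cfc_eq_conj_diagonal hX.1,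
    cfc_eq_conj_diagonal hX.1]
  congr 3
  funext i
  have := hX.eigenvalues_pos i
  rw [mul_inv_cancel₀ (by positivity)]

/-- Each eigenvalue is at most the sum of all, as none is negative. -/
theorem trace_smul_one_sub_posSemidef {A : Matrix n n ℂ} (hA : A.PosSemidef) :
    (A.trace.re • (1 : Matrix n n ℂ) - A).PosSemidef := by
  have hAs : IsSelfAdjoint A := hA.1
  set U := (hA.1.eigenvectorUnitary : Matrix n n ℂ)
  have h1 : A = U * diagonal (fun i => ((hA.1.eigenvalues i : ℝ) : ℂ)) * Uᴴ :=
    (cfc_id' ℝ A).symm.trans (cfc_eq_conj_diagonal hA.1 _)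
  have ht : A.trace.re = ∑ i, hA.1.eigenvalues i := by
    rw [hA.1.trace_eq_sum_eigenvalues]; simp
  have h2 : A.trace.re • (1 : Matrix n n ℂ) - A =
      U * diagonal (fun i => ((A.trace.re - hA.1.eigenvalues i : ℝ) : ℂ)) * Uᴴ := by
    have h3 : diagonal (fun i => ((A.trace.re - hA.1.eigenvalues i : ℝ) : ℂ)) =
        A.trace.re • (1 : Matrix n n ℂ) - diagonal (fun i => ((hA.1.eigenvalues i : ℝ) : ℂ)) := by
      ext i j
      by_cases h : i = j <;> simp [h, one_apply]
    rw [h3, mul_sub, sub_mul, ← h1, mul_smul_comm, smul_mul_assoc, mul_one,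
      eigenvectorUnitary_mul_conjTranspose]
  rw [h2]
  refine PosSemidef.mul_mul_conjTranspose_same (PosSemidef.diagonal fun i => ?_) U
  simp only [Pi.zero_apply]
  rw [Complex.zero_le_real, ht, sub_nonneg]
  exact Finset.single_le_sum (f := hA.1.eigenvalues) (fun j _ => hA.eigenvalues_nonneg j)
    (Finset.mem_univ i)

end Spectral

/-! ### Resolvent bounds for odd perturbations of even matrices. -/

section Resolvent

variable {n : Type*} [Fintype n] [DecidableEq n]

theorem trace_mul_re_nonneg {K D : Matrix n n ℂ} (hK : K.PosSemidef) (hD : D.PosSemidef) :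
    0 ≤ (K * D).trace.re := by
  obtain ⟨B, rfl⟩ : ∃ B : Matrix n n ℂ, D = Bᴴ * B := by
    open scoped MatrixOrder in
    exact CStarAlgebra.nonneg_iff_eq_star_mul_self.mp hD.nonneg
  rw [← mul_assoc, trace_mul_comm, ← mul_assoc]
  exact (Complex.le_def.mp (hK.mul_mul_conjTranspose_same B).trace_nonneg).1

/-- Conjugation by the involution preserves the trace but flips the sign of an odd matrix. -/
theorem trace_eq_zero_of_anticommute {U W : Matrix n n ℂ} (hU : U * U = 1)
    (h : U * W = -(W * U)) : W.trace = 0 := by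
  have h1 : W.trace = -W.trace := by
    calc W.trace = (U * (U * W)).trace := by rw [← mul_assoc, hU, one_mul]
      _ = (-(U * W * U)).trace := by rw [mul_assoc U W U, ← mul_neg, ← h]
      _ = -W.trace := by rw [trace_neg, trace_mul_comm, ← mul_assoc, hU, one_mul]
  exact self_eq_neg.mp h1

/-- The tangent line bound for the operator convex function `Z ↦ Z⁻¹`. -/
theorem inv_sub_tangent_posSemidef {N Z : Matrix n n ℂ} (hN : N.PosDef) (hZ : Z.PosDef) :
    (Z⁻¹ - N⁻¹ - N⁻¹ + N⁻¹ * Z * N⁻¹).PosSemidef := by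
  -- The remainder is the congruence (Z⁻¹ - N⁻¹) Z (Z⁻¹ - N⁻¹).
  have h := hZ.posSemidef.mul_mul_conjTranspose_same (Z⁻¹ - N⁻¹)
  have hZu : IsUnit Z.det := (isUnit_iff_isUnit_det Z).mp hZ.isUnit
  rw [(hZ.inv.isHermitian.sub hN.inv.isHermitian).eq] at h
  convert h using 1
  simp only [sub_mul, mul_sub, nonsing_inv_mul _ hZu, one_mul, mul_assoc, mul_nonsing_inv _ hZu,
    mul_one]
  abel

/-- Operator antitonicity of the inverse. -/
theorem inv_sub_inv_posSemidef {N T : Matrix n n ℂ} (hN : N.PosDef) (hT : (T - N).PosSemidef) :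
    (N⁻¹ - T⁻¹).PosSemidef := by
  have hTd : T.PosDef := by simpa using hN.add_posSemidef hT
  have hTu : IsUnit T.det := (isUnit_iff_isUnit_det T).mp hTd.isUnit
  -- N⁻¹ - T⁻¹ is the tangent remainder at T plus T⁻¹(T - N)T⁻¹.
  have h := hT.mul_mul_conjTranspose_same T⁻¹
  rw [hTd.inv.isHermitian.eq, mul_sub, sub_mul, nonsing_inv_mul _ hTu, one_mul] at h
  convert (inv_sub_tangent_posSemidef hTd hN).add h using 1
  abel

/-- Lower bound for the resolvent of a block-diagonal matrix with an off-diagonal perturbation: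
`U` is the grading, `N` is even and `Y` is odd. -/
theorem trace_resolvent_le {U N Y T : Matrix n n ℂ} {s : ℝ} (hs : 0 ≤ s) (hU : U * U = 1)
    (hUN : U * N = N * U) (hUY : U * Y = -(Y * U)) (hY : Y.IsHermitian) (hN : N.PosDef)
    (hZ : (N + s • Y).PosDef) (hT : (T - N).PosSemidef) :
    s * (Y * T⁻¹ * Y * T⁻¹).trace.re ≤ -(Y * (N + s • Y)⁻¹).trace.re := by
  set Z := N + s • Y with hZdef
  have hTd : T.PosDef := by simpa using hN.add_posSemidef hT
  have hNu : IsUnit N.det := (isUnit_iff_isUnit_det N).mp hN.isUnit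
  have hZu : IsUnit Z.det := (isUnit_iff_isUnit_det Z).mp hZ.isUnit
  have hUN' : U * N⁻¹ = N⁻¹ * U := by
    calc U * N⁻¹ = N⁻¹ * (N * U) * N⁻¹ := by
          rw [← mul_assoc, nonsing_inv_mul _ hNu, one_mul]
      _ = N⁻¹ * U := by rw [← hUN, mul_assoc, mul_assoc, mul_nonsing_inv _ hNu, mul_one]
  have hYN : U * (Y * N⁻¹) = -((Y * N⁻¹) * U) := by
    rw [← mul_assoc, hUY, neg_mul, mul_assoc, hUN', mul_assoc]
  have t1 : (Y * N⁻¹).trace = 0 := trace_eq_zero_of_anticommute hU hYN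
  have t3 : (Y * N⁻¹ * (Y * N⁻¹) * (Y * N⁻¹)).trace = 0 := by
    refine trace_eq_zero_of_anticommute hU ?_
    set W := Y * N⁻¹
    clear_value W
    have h2 : U * (W * W) = W * W * U := by
      rw [← mul_assoc, hYN, neg_mul, mul_assoc, hYN, mul_neg, neg_neg, mul_assoc]
    rw [← mul_assoc, h2, mul_assoc, hYN, mul_neg, mul_assoc (W * W)]
  have pos : ∀ R : Matrix n n ℂ, R.PosSemidef → (Y * R * Y).PosSemidef := fun R hR => by
    simpa [hY.eq] using hR.mul_mul_conjTranspose_same Y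
  have e1 : Z⁻¹ = N⁻¹ - s • (N⁻¹ * Y * Z⁻¹) := by
    have : N⁻¹ * (N + s • Y) * Z⁻¹ = N⁻¹ := by
      rw [← hZdef, mul_assoc, mul_nonsing_inv _ hZu, mul_one]
    rw [mul_add, add_mul, nonsing_inv_mul _ hNu, one_mul, mul_smul_comm, smul_mul_assoc] at this
    exact eq_sub_of_add_eq this
  have e2 : -(Y * Z⁻¹).trace.re = s * (Y * N⁻¹ * Y * Z⁻¹).trace.re := by
    conv_lhs => rw [e1]
    rw [mul_sub, trace_sub, t1, mul_smul_comm, trace_smul]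
    simp [mul_assoc]
  rw [e2]
  refine mul_le_mul_of_nonneg_left ?_ hs
  -- The tangent bound replaces Z⁻¹ by N⁻¹ - s N⁻¹YN⁻¹; the resulting cubic term is odd and drops
  -- out by `t3`.
  have b1 := trace_mul_re_nonneg (pos _ hN.inv.posSemidef) (inv_sub_tangent_posSemidef hN hZ)
  have e3 : N⁻¹ * Z * N⁻¹ = N⁻¹ + s • (N⁻¹ * Y * N⁻¹) := by
    rw [hZdef, mul_add, add_mul, nonsing_inv_mul _ hNu, one_mul, mul_smul_comm, smul_mul_assoc]
  have e4 : Y * N⁻¹ * Y * (N⁻¹ * Y * N⁻¹) = Y * N⁻¹ * (Y * N⁻¹) * (Y * N⁻¹) := by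
    simp only [mul_assoc]
  rw [e3] at b1
  have e5 : Y * N⁻¹ * Y * (Z⁻¹ - N⁻¹ - N⁻¹ + (N⁻¹ + s • (N⁻¹ * Y * N⁻¹))) =
      Y * N⁻¹ * Y * Z⁻¹ - Y * N⁻¹ * Y * N⁻¹ + s • (Y * N⁻¹ * (Y * N⁻¹) * (Y * N⁻¹)) := by
    rw [← e4, ← mul_smul_comm s (Y * N⁻¹ * Y), ← mul_sub, ← mul_add]
    congr 1
    abel
  rw [e5, trace_add, trace_smul, t3, smul_zero, add_zero, trace_sub, Complex.sub_re] at b1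
  have hNT := inv_sub_inv_posSemidef hN hT
  -- The two copies of N⁻¹ are replaced by T⁻¹ one at a time, with cyclicity (`e6`) linking the
  -- bounds.
  have b2 := trace_mul_re_nonneg (pos _ hN.inv.posSemidef) hNT
  have b3 := trace_mul_re_nonneg (pos _ hTd.inv.posSemidef) hNT
  rw [mul_sub, trace_sub, Complex.sub_re] at b2 b3
  have e6 : (Y * T⁻¹ * Y * N⁻¹).trace = (Y * N⁻¹ * Y * T⁻¹).trace := by
    rw [mul_assoc (Y * T⁻¹), trace_mul_comm, ← mul_assoc]
  rw [e6] at b3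
  linarith

end Resolvent

/-! ### Block structure relative to P and its complement. -/

section Blocks

variable {ι : Type*} [Fintype ι] [DecidableEq ι] {P ρ : Matrix ι ι ℂ}

theorem IsOrthProj.compl_mul_compl (hP : IsOrthProj P) : (1 - P) * (1 - P) = 1 - P := by
  rw [mul_sub, sub_mul, sub_mul]; simp [hP.2]

theorem IsOrthProj.mul_compl (hP : IsOrthProj P) : P * (1 - P) = 0 := by
  rw [mul_sub]; simp [hP.2]

theorem IsOrthProj.compl_mul (hP : IsOrthProj P) : (1 - P) * P = 0 := by
  rw [sub_mul]; simp [hP.2]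

theorem IsOrthProj.compl (hP : IsOrthProj P) : IsOrthProj (1 - P) :=
  ⟨isHermitian_one.sub hP.1, hP.compl_mul_compl⟩

theorem IsOrthProj.reflection_mul_self (hP : IsOrthProj P) : (P + P - 1) * (P + P - 1) = 1 := by
  simp only [mul_add, mul_sub, add_mul, sub_mul, hP.2, mul_one, one_mul]; abel

theorem mul_pinching (hP : IsOrthProj P) : P * pinching P ρ = blockA P ρ := by
  rw [pinching, blockA, blockC, mul_add, ← mul_assoc, ← mul_assoc, hP.2, ← mul_assoc, ← mul_assoc,
    hP.mul_compl, zero_mul, zero_mul, add_zero]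

theorem pinching_mul (hP : IsOrthProj P) : pinching P ρ * P = blockA P ρ := by
  rw [pinching, blockA, blockC, add_mul, mul_assoc, hP.2, mul_assoc (_ * _), hP.compl_mul,
    mul_zero, add_zero]

theorem reflection_mul_pinching (hP : IsOrthProj P) :
    (P + P - 1) * pinching P ρ = pinching P ρ * (P + P - 1) := by
  simp only [mul_add, mul_sub, add_mul, sub_mul, mul_pinching hP, pinching_mul hP, one_mul, mul_one]

theorem mul_coherence (hP : IsOrthProj P) : P * (ρ - pinching P ρ) = blockB P ρ := by
  rw [mul_sub, mul_pinching hP, blockA, blockB, mul_sub, mul_one]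

theorem coherence_mul_compl (hP : IsOrthProj P) :
    (ρ - pinching P ρ) * (1 - P) = blockB P ρ := by
  rw [mul_sub, mul_one, sub_mul, pinching_mul hP, pinching, blockA, blockC, blockB]
  noncomm_ring

theorem reflection_mul_coherence (hP : IsOrthProj P) :
    (P + P - 1) * (ρ - pinching P ρ) = -((ρ - pinching P ρ) * (P + P - 1)) := by
  have h := (mul_coherence (ρ := ρ) hP).trans (coherence_mul_compl hP).symm
  rw [sub_mul, add_mul, h]
  noncomm_ring

theorem coherence_isHermitian (hP : IsOrthProj P) (hρ : ρ.IsHermitian) :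
    (ρ - pinching P ρ).IsHermitian := by
  have h1 := isHermitian_mul_mul_conjTranspose P hρ
  have h2 := isHermitian_mul_mul_conjTranspose (1 - P) hρ
  rw [hP.1.eq] at h1
  rw [hP.compl.1.eq] at h2
  exact hρ.sub (h1.add h2)

theorem coherence_eq (hP : IsOrthProj P) (hρ : ρ.IsHermitian) :
    ρ - pinching P ρ = blockB P ρ + (blockB P ρ)ᴴ := by
  simp only [blockB, pinching, blockA, blockC, conjTranspose_mul, conjTranspose_sub, hP.1.eq,
    hρ.eq, conjTranspose_one]
  noncomm_ring

theorem trace_mul_conjTranspose_self_re {κ : Type*} [Fintype κ] (B : Matrix κ κ ℂ) : (B * Bᴴ).trace.re = frobSq B := by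
  simp only [trace, diag_apply, mul_apply, conjTranspose_apply, Complex.re_sum, frobSq]
  refine Finset.sum_congr rfl fun i _ => Finset.sum_congr rfl fun j _ => ?_
  rw [← Complex.normSq_eq_norm_sq, Complex.normSq_apply]
  simp

theorem trace_coherence_mul_self (hP : IsOrthProj P) (hρ : ρ.IsHermitian) :
    ((ρ - pinching P ρ) * (ρ - pinching P ρ)).trace.re = 2 * frobSq (blockB P ρ) := by
  have hB : blockB P ρ * blockB P ρ = 0 := by
    rw [blockB, mul_assoc, ← mul_assoc (1 - P), ← mul_assoc (1 - P), hP.compl_mul]; simp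
  have hB' : (blockB P ρ)ᴴ * (blockB P ρ)ᴴ = 0 := by
    rw [← conjTranspose_mul, hB, conjTranspose_zero]
  rw [coherence_eq hP hρ, mul_add, add_mul, add_mul, hB, hB', zero_add, add_zero, trace_add,
    trace_mul_comm, Complex.add_re, trace_mul_conjTranspose_self_re]
  ring

theorem trace_blockA_add_blockC (hP : IsOrthProj P) :
    (blockA P ρ).trace + (blockC P ρ).trace = ρ.trace := by
  rw [blockA, blockC, trace_mul_comm, ← mul_assoc, hP.2, trace_mul_comm (_ * ρ), ← mul_assoc,
    hP.compl_mul_compl, ← trace_add, ← add_mul, add_sub_cancel, one_mul]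

theorem trace_blockA_re (hP : IsOrthProj P) (hρ : IsDensityMatrix ρ) :
    (blockA P ρ).trace.re = 1 - leakage P ρ := by
  have h := congrArg Complex.re (trace_blockA_add_blockC (ρ := ρ) hP)
  rw [hρ.2, Complex.add_re, Complex.one_re] at h
  rw [leakage]; linarith

theorem blockA_posSemidef {κ : Type*} [Fintype κ] {P ρ : Matrix κ κ ℂ} (hP : IsOrthProj P) (hρ : ρ.PosSemidef) : (blockA P ρ).PosSemidef := by
  have h := hρ.mul_mul_conjTranspose_same P
  rwa [hP.1.eq] at h

theorem blockC_posSemidef (hP : IsOrthProj P) (hρ : ρ.PosSemidef) : (blockC P ρ).PosSemidef :=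
  blockA_posSemidef hP.compl hρ

theorem trace_smul_sub_blockA_posSemidef (hP : IsOrthProj P) (hρ : ρ.PosSemidef) :
    ((blockA P ρ).trace.re • P - blockA P ρ).PosSemidef := by
  have h := (trace_smul_one_sub_posSemidef (blockA_posSemidef hP hρ)).mul_mul_conjTranspose_same P
  rw [hP.1.eq, mul_sub, sub_mul, mul_smul_comm, smul_mul_assoc, mul_one, hP.2] at h
  convert h using 2
  rw [blockA, ← mul_assoc, ← mul_assoc, hP.2, mul_assoc (_ * _), hP.2]

/-- Y exchanges the ranges of P and Q, so moving the inverse across Y swaps α and β; the two inverse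
factors then multiply to a scalar. -/
theorem coherence_mul_inv_blocks (hP : IsOrthProj P) {α β : ℝ} (hα : 0 < α) (hβ : 0 < β) :
    (ρ - pinching P ρ) * (α • P + β • (1 - P))⁻¹ * (ρ - pinching P ρ) *
        (α • P + β • (1 - P))⁻¹ =
      (α * β)⁻¹ • ((ρ - pinching P ρ) * (ρ - pinching P ρ)) := by
  have hinv : (α • P + β • (1 - P))⁻¹ = α⁻¹ • P + β⁻¹ • (1 - P) := by
    refine inv_eq_right_inv ?_
    simp only [mul_add, add_mul, smul_mul_smul_comm, hP.2, hP.compl_mul, hP.mul_compl,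
      hP.compl_mul_compl, smul_zero, mul_inv_cancel₀ hα.ne', mul_inv_cancel₀ hβ.ne']
    simp
  rw [hinv]
  have h1 : P * (ρ - pinching P ρ) = (ρ - pinching P ρ) * (1 - P) :=
    (mul_coherence hP).trans (coherence_mul_compl hP).symm
  set Y := ρ - pinching P ρ
  have h2 : (1 - P) * Y = Y * P := by rw [sub_mul, h1]; noncomm_ring
  have h3 : (α⁻¹ • P + β⁻¹ • (1 - P)) * Y = Y * (α⁻¹ • (1 - P) + β⁻¹ • P) := by
    simp only [add_mul, mul_add, smul_mul_assoc, mul_smul_comm, h1, h2]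
  have h4 : (α⁻¹ • (1 - P) + β⁻¹ • P) * (α⁻¹ • P + β⁻¹ • (1 - P)) =
      (α * β)⁻¹ • (1 : Matrix ι ι ℂ) := by
    simp only [mul_add, add_mul, smul_mul_smul_comm, hP.2, hP.compl_mul, hP.mul_compl,
      hP.compl_mul_compl, smul_zero, mul_inv, mul_comm β⁻¹ α⁻¹, add_zero, zero_add]
    rw [← smul_add]
    simp
  rw [mul_assoc Y _ Y, h3, ← mul_assoc, mul_assoc (Y * Y), h4, mul_smul_comm, mul_one]

/-- A lower bound for the resolvent of the orbit against its coherence part. -/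
theorem trace_coherence_resolvent_le (hP : IsOrthProj P) (hρ : IsDensityMatrix ρ)
    (hM : (pinching P ρ).PosDef) {s r : ℝ} (hs : 0 ≤ s) (hr : 0 ≤ r)
    (hZ : (pinching P ρ + s • (ρ - pinching P ρ)).PosDef)
    (hε : 0 < leakage P ρ) (hε1 : leakage P ρ < 1) :
    s * (2 * frobSq (blockB P ρ)) * ((1 - leakage P ρ + r) * (leakage P ρ + r))⁻¹ ≤
      -((ρ - pinching P ρ) *
        (pinching P ρ + s • (ρ - pinching P ρ) + r • (1 : Matrix ι ι ℂ))⁻¹).trace.re := by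
  have hr1 : (r • (1 : Matrix ι ι ℂ)).PosSemidef := PosSemidef.one.smul hr
  have hα : 0 < 1 - leakage P ρ + r := by linarith
  have hβ : 0 < leakage P ρ + r := by linarith
  have hswap : pinching P ρ + s • (ρ - pinching P ρ) + r • (1 : Matrix ι ι ℂ) =
      (pinching P ρ + r • (1 : Matrix ι ι ℂ)) + s • (ρ - pinching P ρ) := by abel
  have hT : ((1 - leakage P ρ + r) • P + (leakage P ρ + r) • (1 - P) -
      (pinching P ρ + r • (1 : Matrix ι ι ℂ))).PosSemidef := by
    have h1 := trace_smul_sub_blockA_posSemidef hP hρ.1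
    have h2 : (leakage P ρ • (1 - P) - blockC P ρ).PosSemidef :=
      trace_smul_sub_blockA_posSemidef hP.compl hρ.1
    rw [trace_blockA_re hP hρ] at h1
    convert h1.add h2 using 1
    rw [pinching]
    simp only [add_smul, smul_sub]
    abel
  have key := trace_resolvent_le hs hP.reflection_mul_self
    (N := pinching P ρ + r • (1 : Matrix ι ι ℂ))
    (by rw [mul_add, add_mul, reflection_mul_pinching hP]; simp)
    (reflection_mul_coherence hP) (coherence_isHermitian hP hρ.1.1) (hM.add_posSemidef hr1)
    (by rw [← hswap]; exact hZ.add_posSemidef hr1) hT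
  rw [coherence_mul_inv_blocks hP hα hβ, trace_smul, Complex.smul_re,
    trace_coherence_mul_self hP hρ.1.1, smul_eq_mul] at key
  rw [hswap]
  linarith

end Blocks

/-- Integrating a resolvent bound over `r ∈ [0, ∞)` gives a logarithmic bound. -/
theorem log_bound_of_resolvent_bound {κ : Type*} [Fintype κ] {x y : κ → ℝ} {a b K : ℝ}
    (hx : ∀ i, 0 < x i) (hy : ∑ i, y i = 0) (hb : 0 < b) (hab : b < a)
    (h : ∀ r : ℝ, 0 ≤ r → K * ((a + r) * (b + r))⁻¹ ≤ -∑ i, (x i + r)⁻¹ * y i) :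
    K / (a - b) * (Real.log a - Real.log b) ≤ ∑ i, Real.log (x i) * y i := by
  -- G replaces the improper integral: it is antitone by the resolvent bound and tends to 0, so G 0
  -- ≥ 0.
  set G : ℝ → ℝ := fun r => (∑ i, Real.log (x i + r) * y i) -
    K / (a - b) * (Real.log (a + r) - Real.log (b + r)) with hG
  have hlog : ∀ c : ℝ, 0 < c → ∀ r : ℝ, 0 ≤ r →
      HasDerivAt (fun r => Real.log (c + r)) (c + r)⁻¹ r := fun c hc r hr => by
    simpa using ((hasDerivAt_id r).const_add c).log (by simp only [id]; positivity)
  have hd : ∀ r : ℝ, 0 ≤ r → HasDerivAt G ((∑ i, (x i + r)⁻¹ * y i) -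
      K / (a - b) * ((a + r)⁻¹ - (b + r)⁻¹)) r := fun r hr =>
    (HasDerivAt.fun_sum fun i _ => (hlog _ (hx i) r hr).mul_const (y i)).sub
      (((hlog a (hb.trans hab) r hr).sub (hlog b hb r hr)).const_mul _)
  have hanti : AntitoneOn G (Set.Ici 0) := by
    refine antitoneOn_of_deriv_nonpos (convex_Ici 0)
      (fun r hr => (hd r hr).continuousAt.continuousWithinAt)
      (fun r hr => (hd r (interior_subset hr)).differentiableAt.differentiableWithinAt)
      fun r hr => ?_
    have hr0 : 0 ≤ r := interior_subset hr
    rw [(hd r hr0).deriv]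
    have e : K / (a - b) * ((a + r)⁻¹ - (b + r)⁻¹) = -(K * ((a + r) * (b + r))⁻¹) := by
      have h1 : a - b ≠ 0 := by linarith
      have h2 : a + r ≠ 0 := by linarith
      have h3 : b + r ≠ 0 := by linarith
      field_simp
      ring
    rw [e]
    linarith [h r hr0]
  have hlim : Tendsto G atTop (𝓝 0) := by
    -- Since the weights y sum to zero, log r can be subtracted from every term, and each difference
    -- tends to 0.
    have hG' : G = fun r => (∑ i, (Real.log (r + x i) - Real.log r) * y i) -
        K / (a - b) * ((Real.log (r + a) - Real.log r) - (Real.log (r + b) - Real.log r)) := by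
      funext r
      simp only [hG, sub_mul, Finset.sum_sub_distrib, ← Finset.mul_sum, hy, mul_zero, sub_zero,
        add_comm r]
      ring
    rw [hG']
    have h1 := tendsto_finsetSum (Finset.univ : Finset κ) fun i _ =>
      (Real.tendsto_log_comp_add_sub_log (x i)).mul_const (y i)
    have h2 := ((Real.tendsto_log_comp_add_sub_log a).sub
      (Real.tendsto_log_comp_add_sub_log b)).const_mul (K / (a - b))
    simpa using h1.sub h2
  have h0 : 0 ≤ G 0 := le_of_tendsto hlim
    ((eventually_ge_atTop 0).mono fun r hr => hanti Set.self_mem_Ici hr hr)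
  simp only [hG, add_zero] at h0
  linarith

/-! ### Entropy along the segment and the orbit. -/

section Orbit

variable {ι : Type*} [Fintype ι] [DecidableEq ι] {P ρ : Matrix ι ι ℂ}

/-- The segment `s ↦ M + s Y` through the pinched state. -/
def segment (P ρ : Matrix ι ι ℂ) (s : ℝ) : Matrix ι ι ℂ :=
  pinching P ρ + s • (ρ - pinching P ρ)

/-- The negative entropy along the segment. -/
def segmentNegEntropy (P ρ : Matrix ι ι ℂ) (s : ℝ) : ℝ :=
  (segment P ρ s * logm (segment P ρ s)).trace.re

/-- The derivative of the negative entropy along the segment. -/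
def segmentSlope (P ρ : Matrix ι ι ℂ) (s : ℝ) : ℝ :=
  ((ρ - pinching P ρ) * logm (segment P ρ s)).trace.re

theorem segment_one : segment P ρ 1 = ρ := by simp [segment]

theorem segment_sub (s s' : ℝ) :
    segment P ρ s' - segment P ρ s = (s' - s) • (ρ - pinching P ρ) := by
  rw [segment, segment, sub_smul]; abel

theorem segment_posDef (hρ : ρ.PosSemidef) (hM : (pinching P ρ).PosDef) {s : ℝ}
    (h0 : 0 ≤ s) (h1 : s < 1) : (segment P ρ s).PosDef := by
  have e : segment P ρ s = (1 - s) • pinching P ρ + s • ρ := by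
    rw [segment, smul_sub, sub_smul, one_smul]; abel
  rw [e]
  exact (hM.smul (sub_pos.mpr h1)).add_posSemidef (hρ.smul h0)

theorem trace_coherence (hP : IsOrthProj P) : (ρ - pinching P ρ).trace = 0 :=
  trace_eq_zero_of_anticommute hP.reflection_mul_self (reflection_mul_coherence hP)

theorem trace_segment (hP : IsOrthProj P) (s : ℝ) :
    (segment P ρ s).trace = (pinching P ρ).trace := by
  rw [segment, trace_add, trace_smul, trace_coherence hP, smul_zero, add_zero]

theorem trace_coherence_mul_logm_pinching (hP : IsOrthProj P) :
    ((ρ - pinching P ρ) * logm (pinching P ρ)).trace = 0 := by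
  refine trace_eq_zero_of_anticommute hP.reflection_mul_self ?_
  have hc : Commute (pinching P ρ) (P + P - 1) := (reflection_mul_pinching hP).symm
  have hl : logm (pinching P ρ) * (P + P - 1) = (P + P - 1) * logm (pinching P ρ) :=
    hc.cfc_real Real.log
  rw [← mul_assoc, reflection_mul_coherence hP, mul_assoc, hl, neg_mul, mul_assoc]

theorem orbitEntropy_eq (hP : IsOrthProj P) (Γ t : ℝ) :
    orbitEntropy Γ P ρ t = segmentNegEntropy P ρ (Real.exp (-Γ * t)) -
      (pinching P ρ * logm (pinching P ρ)).trace.re := by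
  have h : (segment P ρ (Real.exp (-Γ * t)) * logm (pinching P ρ)).trace =
      (pinching P ρ * logm (pinching P ρ)).trace := by
    rw [segment, add_mul, smul_mul_assoc, trace_add, trace_smul,
      trace_coherence_mul_logm_pinching hP, smul_zero, add_zero]
  rw [← h, segmentNegEntropy, ← Complex.sub_re, ← trace_sub, ← mul_sub]
  rfl

/-- The slope is a subgradient of the negative entropy. -/
theorem segmentNegEntropy_subgradient (hP : IsOrthProj P) {s s' : ℝ}
    (hs : (segment P ρ s).PosDef) (hs' : (segment P ρ s').PosSemidef) :
    (s' - s) * segmentSlope P ρ s ≤ segmentNegEntropy P ρ s' - segmentNegEntropy P ρ s := by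
  have h := klein_inequality hs' hs
  rw [trace_segment hP, trace_segment hP, sub_self] at h
  have e : (segment P ρ s' * logm (segment P ρ s)).trace.re =
      segmentNegEntropy P ρ s + (s' - s) * segmentSlope P ρ s := by
    rw [← sub_add_cancel (segment P ρ s') (segment P ρ s), segment_sub, add_mul, smul_mul_assoc,
      trace_add, trace_smul, Complex.add_re, Complex.smul_re, smul_eq_mul, add_comm]
    rfl
  rw [e] at h
  change _ ≤ segmentNegEntropy P ρ s' - _ at h
  linarith

open scoped Matrix.Norms.L2Operator in
theorem segmentSlope_continuousOn :
    ContinuousOn (segmentSlope P ρ) {s | (segment P ρ s).PosDef} := by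
  have h1 : ContinuousOn (fun s => logm (segment P ρ s)) {s | (segment P ρ s).PosDef} := by
    refine (CFC.continuousOn_log (A := Matrix ι ι ℂ)).comp (f := segment P ρ) ?_
      fun s hs => ⟨hs.isHermitian, hs.isUnit⟩
    refine Continuous.continuousOn ?_
    unfold segment
    fun_prop
  have h2 : Continuous fun W : Matrix ι ι ℂ => ((ρ - pinching P ρ) * W).trace.re :=
    Complex.continuous_re.comp ((continuous_const.matrix_mul continuous_id).matrix_trace)
  exact h2.comp_continuousOn h1

/-- Subgradients at both ends trap the increment, and continuity of the slope closes the gap; the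
matrix logarithm need not be differentiated. -/
theorem hasDerivWithinAt_segmentNegEntropy (hP : IsOrthProj P) {s : ℝ}
    (hs : (segment P ρ s).PosDef) :
    HasDerivWithinAt (segmentNegEntropy P ρ) (segmentSlope P ρ s)
      {s | (segment P ρ s).PosDef} s := by
  rw [hasDerivWithinAt_iff_isLittleO, Asymptotics.isLittleO_iff]
  intro c hc
  have hcont := Metric.continuousWithinAt_iff'.mp (segmentSlope_continuousOn (P := P) s hs) c hc
  filter_upwards [hcont, self_mem_nhdsWithin] with s' h1 h2
  have l1 := segmentNegEntropy_subgradient hP hs h2.posSemidef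
  have l2 := segmentNegEntropy_subgradient hP h2 hs.posSemidef
  rw [Real.dist_eq] at h1
  rw [smul_eq_mul, Real.norm_of_nonneg (by linarith), Real.norm_eq_abs]
  calc segmentNegEntropy P ρ s' - segmentNegEntropy P ρ s - (s' - s) * segmentSlope P ρ s
      ≤ (segmentSlope P ρ s' - segmentSlope P ρ s) * (s' - s) := by linarith
    _ ≤ |segmentSlope P ρ s' - segmentSlope P ρ s| * |s' - s| := by
      rw [← abs_mul]; exact le_abs_self _
    _ ≤ c * |s' - s| := by gcongr

theorem leakage_nonneg (hP : IsOrthProj P) (hρ : ρ.PosSemidef) : 0 ≤ leakage P ρ :=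
  (Complex.le_def.mp (blockC_posSemidef hP hρ).trace_nonneg).1

/-- Writing ρ = R*R, zero leakage forces RQ = 0 and hence PρQ = 0. -/
theorem leakage_pos (hP : IsOrthProj P) (hρ : ρ.PosSemidef) (hB : blockB P ρ ≠ 0) :
    0 < leakage P ρ := by
  refine (leakage_nonneg hP hρ).lt_of_ne fun h => hB ?_
  have hpos := blockC_posSemidef hP hρ
  have h0 : blockC P ρ = 0 := by
    rw [← hpos.trace_eq_zero_iff]
    exact Complex.ext h.symm (Complex.le_def.mp hpos.trace_nonneg).2.symm
  obtain ⟨R, hR⟩ : ∃ R : Matrix ι ι ℂ, ρ = Rᴴ * R := by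
    open scoped MatrixOrder in
    exact CStarAlgebra.nonneg_iff_eq_star_mul_self.mp hρ.nonneg
  have h1 : (R * (1 - P))ᴴ * (R * (1 - P)) = 0 := by
    rw [conjTranspose_mul, hP.compl.1.eq, ← h0, blockC, hR]
    simp only [mul_assoc]
  rw [conjTranspose_mul_self_eq_zero] at h1
  rw [blockB, hR, mul_assoc, mul_assoc, h1, mul_zero, mul_zero]

/-- Compare a₀P ≤ A ≤ (Tr A)P and take traces; P ≠ 0 has positive trace. -/
theorem le_one_sub_leakage (hP : IsOrthProj P) (hρ : IsDensityMatrix ρ) {a₀ : ℝ}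
    (hA : (blockA P ρ - a₀ • P).PosSemidef) (hP0 : P ≠ 0) : a₀ ≤ 1 - leakage P ρ := by
  have hPpos : P.PosSemidef := by
    have h := posSemidef_conjTranspose_mul_self P
    rwa [hP.1.eq, hP.2] at h
  have h1 := trace_smul_sub_blockA_posSemidef hP hρ.1
  have h2 := (Complex.le_def.mp (h1.add hA).trace_nonneg).1
  have h3 : (blockA P ρ).trace.re • P - blockA P ρ + (blockA P ρ - a₀ • P) =
      (1 - leakage P ρ - a₀) • P := by
    rw [trace_blockA_re hP hρ, sub_smul _ a₀]; abel
  rw [h3, trace_smul, Complex.smul_re, smul_eq_mul, Complex.zero_re] at h2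
  have h4 := Complex.le_def.mp hPpos.trace_nonneg
  have h5 : 0 < P.trace.re := by
    refine h4.1.lt_of_ne fun h => hP0 ?_
    rw [← hPpos.trace_eq_zero_iff]
    exact Complex.ext h.symm h4.2.symm
  linarith [nonneg_of_mul_nonneg_left h2 h5]

/-- The slope bound, together with the sign of its right-hand side. -/
theorem le_segmentSlope (hP : IsOrthProj P) (hρ : IsDensityMatrix ρ)
    (hM : (pinching P ρ).PosDef) {a₀ : ℝ} (hA : (blockA P ρ - a₀ • P).PosSemidef)
    (hC : leakage P ρ ≤ a₀ / 2) {s : ℝ} (hs : 0 ≤ s) (hZ : (segment P ρ s).PosDef) :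
    0 ≤ frobSq (blockB P ρ) * Real.log (a₀ / leakage P ρ) ∧
      s * (2 * (frobSq (blockB P ρ) * Real.log (a₀ / leakage P ρ))) ≤ segmentSlope P ρ s := by
  -- Without coherence both sides vanish, whatever value the logarithm takes; this covers Q = 0.
  by_cases hB : blockB P ρ = 0
  · have hY : ρ - pinching P ρ = 0 := by rw [coherence_eq hP hρ.1.1, hB]; simp
    have hF : frobSq (blockB P ρ) = 0 := by rw [hB]; simp [frobSq]
    rw [hF, segmentSlope, hY]
    simp
  have hε := leakage_pos hP hρ.1 hB
  have ha := le_one_sub_leakage hP hρ hA fun h => hB (by rw [blockB, h]; simp)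
  have hF : 0 ≤ frobSq (blockB P ρ) :=
    Finset.sum_nonneg fun i _ => Finset.sum_nonneg fun j _ => by positivity
  have hlog : 0 ≤ Real.log (a₀ / leakage P ρ) :=
    Real.log_nonneg (by rw [le_div_iff₀ hε]; linarith)
  refine ⟨mul_nonneg hF hlog, ?_⟩
  have hH := hZ.isHermitian
  set y : ι → ℝ := fun i => (((hH.eigenvectorUnitary : Matrix ι ι ℂ)ᴴ * (ρ - pinching P ρ) *
        (hH.eigenvectorUnitary : Matrix ι ι ℂ)) i i).re with hy
  have hy0 : ∑ i, y i = 0 := by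
    have h := trace_mul_cfc_re hH (ρ - pinching P ρ) (fun _ : ℝ => (1 : ℝ))
    have hH' : IsSelfAdjoint (segment P ρ s) := hH
    rw [cfc_const_one ℝ (segment P ρ s), mul_one, trace_coherence hP] at h
    simpa using h.symm
  have key := log_bound_of_resolvent_bound (x := hH.eigenvalues) (y := y)
    (a := 1 - leakage P ρ) (b := leakage P ρ) (K := s * (2 * frobSq (blockB P ρ)))
    hZ.eigenvalues_pos hy0 hε (by linarith) fun r hr => by
      have h := trace_coherence_resolvent_le hP hρ hM hs hr hZ hε (by linarith)
      rw [← segment, add_smul_one_inv_eq_cfc hZ hr, trace_mul_cfc_re hH] at h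
      exact h
  have hL : segmentSlope P ρ s = ∑ i, Real.log (hH.eigenvalues i) * y i :=
    trace_mul_cfc_re hH _ _
  rw [hL]
  refine le_trans ?_ key
  have hle : Real.log (a₀ / leakage P ρ) ≤
      Real.log (1 - leakage P ρ) - Real.log (leakage P ρ) := by
    rw [Real.log_div (by linarith) hε.ne']
    linarith [Real.log_le_log (by linarith) ha]
  have hK : 0 ≤ s * (2 * frobSq (blockB P ρ)) := by positivity
  -- The factor 1/(1 - 2ε) from the integral is at least 1 and is discarded.
  calc s * (2 * (frobSq (blockB P ρ) * Real.log (a₀ / leakage P ρ)))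
      = s * (2 * frobSq (blockB P ρ)) * Real.log (a₀ / leakage P ρ) := by ring
    _ ≤ s * (2 * frobSq (blockB P ρ)) / (1 - leakage P ρ - leakage P ρ) *
        Real.log (a₀ / leakage P ρ) := by
      refine mul_le_mul_of_nonneg_right ?_ hlog
      exact le_div_self hK (by linarith) (by linarith)
    _ ≤ _ := by
      refine mul_le_mul_of_nonneg_left hle (div_nonneg hK (by linarith))

/-- Difference quotients at `t = 0` increase as the step decreases. -/
theorem orbit_quotient_antitoneOn (hP : IsOrthProj P) (hρ : ρ.PosSemidef)
    (hM : (pinching P ρ).PosDef) {Γ : ℝ} (hΓ : 0 < Γ)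
    (hL : ∀ s, 0 ≤ s → s < 1 → 0 ≤ segmentSlope P ρ s) :
    AntitoneOn (fun h : ℝ => -((orbitEntropy Γ P ρ h - orbitEntropy Γ P ρ 0) / h))
      (Set.Ioi 0) := by
  intro k hk h hh hkh
  rw [Set.mem_Ioi] at hk hh
  simp only [orbitEntropy_eq hP, mul_zero, Real.exp_zero]
  set s := Real.exp (-Γ * k) with hs
  set u := Real.exp (-Γ * h) with hu
  have hs0 : 0 < s := Real.exp_pos _
  have hu0 : 0 < u := Real.exp_pos _
  have hs1 : s < 1 := Real.exp_lt_one_iff.mpr (by nlinarith)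
  have hus : u ≤ s := Real.exp_le_exp.mpr (by nlinarith)
  have hS := segment_posDef hρ hM hs0.le hs1
  have b1 := segmentNegEntropy_subgradient hP hS (s' := 1) (by rwa [segment_one])
  have b2 := segmentNegEntropy_subgradient hP hS
    (segment_posDef hρ hM hu0.le (hus.trans_lt hs1)).posSemidef
  have hLs := hL s hs0.le hs1
  set L := segmentSlope P ρ s
  set D := segmentNegEntropy P ρ 1 - segmentNegEntropy P ρ s with hD
  have c1 : s - u ≤ s * (Γ * (h - k)) := by
    have e : u = s * Real.exp (-(Γ * (h - k))) := by
      rw [hu, hs, ← Real.exp_add]; congr 1; ring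
    have := Real.add_one_le_exp (-(Γ * (h - k)))
    rw [e]
    nlinarith
  have c2 : s * (Γ * k) ≤ 1 - s := by
    have e : s * Real.exp (Γ * k) = 1 := by
      rw [hs, ← Real.exp_add]; simp
    have := Real.add_one_le_exp (Γ * k)
    nlinarith
  -- Chord inequality for the convex exponential at times 0, k, h.
  have c3 : k * (s - u) ≤ (h - k) * (1 - s) := by
    have d1 := mul_le_mul_of_nonneg_left c1 hk.le
    have d2 := mul_le_mul_of_nonneg_left c2 (sub_nonneg.mpr hkh)
    linarith
  have c4 : k * ((s - u) * L) ≤ (h - k) * D := by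
    have d1 := mul_le_mul_of_nonneg_right c3 hLs
    have d2 := mul_le_mul_of_nonneg_left b1 (sub_nonneg.mpr hkh)
    linarith
  rw [← neg_div, ← neg_div, div_le_div_iff₀ hh hk]
  have d3 := mul_le_mul_of_nonneg_left b2 hk.le
  rw [hD] at c4
  linarith

end Orbit

end Dephasing

end

/-- At `t = 0` the derivative is the one-sided (right) derivative, which exists in the extended
reals: it is finite when `ρ` is positive definite and may be infinite when `ρ` is singular. -/
theorem corollary5p2 {ι : Type*} [Fintype ι] [DecidableEq ι]
    (P ρ : Matrix ι ι ℂ) (Γ a₀ : ℝ)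
    (hP : Dephasing.IsOrthProj P) (hρ : Dephasing.IsDensityMatrix ρ) (hΓ : 0 < Γ)
    (hM : (Dephasing.pinching P ρ).PosDef)
    (hA : (Dephasing.blockA P ρ - a₀ • P).PosSemidef)
    (hC : Dephasing.leakage P ρ ≤ a₀ / 2) :
    (∀ t : ℝ, 0 < t →
      DifferentiableAt ℝ (Dephasing.orbitEntropy Γ P ρ) t ∧
      2 * Γ * Real.exp (-2 * Γ * t) * Dephasing.frobSq (Dephasing.blockB P ρ) *
          Real.log (a₀ / Dephasing.leakage P ρ)
        ≤ -deriv (Dephasing.orbitEntropy Γ P ρ) t) ∧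
    (∃ L : EReal,
      Filter.Tendsto
        (fun h : ℝ =>
          ((-((Dephasing.orbitEntropy Γ P ρ h - Dephasing.orbitEntropy Γ P ρ 0) / h) : ℝ) : EReal))
        (nhdsWithin 0 (Set.Ioi 0)) (nhds L) ∧
      ((2 * Γ * Dephasing.frobSq (Dephasing.blockB P ρ) *
          Real.log (a₀ / Dephasing.leakage P ρ) : ℝ) : EReal) ≤ L) ∧
    (ρ.PosDef → DifferentiableWithinAt ℝ (Dephasing.orbitEntropy Γ P ρ) (Set.Ici 0) 0) := by
  open Dephasing in
  have hexp : ∀ t : ℝ, HasDerivAt (fun t => Real.exp (-Γ * t)) (-Γ * Real.exp (-Γ * t)) t :=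
    fun t => by simpa [mul_comm] using ((hasDerivAt_id t).const_mul (-Γ)).exp
  have hexp1 : ∀ t : ℝ, 0 < t → Real.exp (-Γ * t) < 1 := fun t ht =>
    Real.exp_lt_one_iff.mpr (by nlinarith)
  have horb : orbitEntropy Γ P ρ = fun t => segmentNegEntropy P ρ (Real.exp (-Γ * t)) -
      (pinching P ρ * logm (pinching P ρ)).trace.re := funext fun t => orbitEntropy_eq hP Γ t
  have hL := fun s (h0 : 0 ≤ s) (h1 : s < 1) =>
    le_segmentSlope hP hρ hM hA hC h0 (segment_posDef hρ.1 hM h0 h1)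
  set F := frobSq (blockB P ρ) * Real.log (a₀ / leakage P ρ) with hF
  refine ⟨fun t ht => ?_, ?_, fun hρ' => ?_⟩
  · have hs0 := Real.exp_pos (-Γ * t)
    have hs1 := hexp1 t ht
    have hd : HasDerivAt (orbitEntropy Γ P ρ)
        (segmentSlope P ρ (Real.exp (-Γ * t)) * (-Γ * Real.exp (-Γ * t))) t := by
      rw [horb]
      refine HasDerivAt.sub_const _ (HasDerivAt.comp (h₂ := segmentNegEntropy P ρ) t ?_ (hexp t))
      refine (hasDerivWithinAt_segmentNegEntropy hP
        (segment_posDef hρ.1 hM hs0.le hs1)).hasDerivAt ?_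
      filter_upwards [Ioo_mem_nhds hs0 hs1] with s hs
      exact segment_posDef hρ.1 hM hs.1.le hs.2
    refine ⟨hd.differentiableAt, ?_⟩
    rw [hd.deriv]
    have h1 := mul_le_mul_of_nonneg_left (hL _ hs0.le hs1).2 (mul_pos hΓ hs0).le
    have e : Real.exp (-2 * Γ * t) = Real.exp (-Γ * t) * Real.exp (-Γ * t) := by
      rw [← Real.exp_add]; congr 1; ring
    rw [e]
    linarith
  · have hanti := orbit_quotient_antitoneOn hP hρ.1 hM hΓ fun s h0 h1 =>
      le_trans (mul_nonneg h0 (mul_nonneg zero_le_two (hL s h0 h1).1)) (hL s h0 h1).2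
    have hlim := AntitoneOn.tendsto_nhdsGT (x := (0 : ℝ))
      (f := fun h : ℝ => ((-((orbitEntropy Γ P ρ h - orbitEntropy Γ P ρ 0) / h) : ℝ) : EReal))
      (fun k hk h hh hkh => EReal.coe_le_coe_iff.mpr (hanti hk hh hkh)) (OrderTop.bddAbove _)
    refine ⟨_, hlim, ?_⟩
    -- This minorant of the quotient uses the subgradient at s = e^{-Γh} < 1, so no slope is needed
    -- at the possibly singular ρ.
    have hlow : Filter.Tendsto (fun h : ℝ => -(Real.exp (-Γ * h) - 1) / h *
        (Real.exp (-Γ * h) * (2 * F))) (nhdsWithin 0 (Set.Ioi 0))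
        (nhds (2 * Γ * frobSq (blockB P ρ) * Real.log (a₀ / leakage P ρ))) := by
      have h1 := (hexp 0).tendsto_slope_zero_right
      have h2 : Filter.Tendsto (fun h : ℝ => Real.exp (-Γ * h)) (nhdsWithin 0 (Set.Ioi 0))
          (nhds (Real.exp (-Γ * 0))) := (hexp 0).continuousAt.tendsto.mono_left nhdsWithin_le_nhds
      have h3 := h1.neg.mul (h2.mul_const (2 * F))
      simp only [mul_zero, Real.exp_zero, zero_add, mul_one, one_mul, smul_eq_mul, neg_neg] at h3
      convert h3 using 2
      · ring
      · rw [hF]; ring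
    refine le_of_tendsto_of_tendsto ((continuous_coe_real_ereal.tendsto _).comp hlow) hlim ?_
    filter_upwards [self_mem_nhdsWithin] with h hh
    rw [Set.mem_Ioi] at hh
    refine EReal.coe_le_coe_iff.mpr ?_
    have hs0 := Real.exp_pos (-Γ * h)
    have hs1 := hexp1 h hh
    have b1 := segmentNegEntropy_subgradient hP (segment_posDef hρ.1 hM hs0.le hs1) (s' := 1)
      (by rw [segment_one]; exact hρ.1)
    have b2 := mul_le_mul_of_nonneg_left (hL _ hs0.le hs1).2 (sub_nonneg.mpr hs1.le)
    simp only [orbitEntropy_eq hP, mul_zero, Real.exp_zero]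
    rw [← neg_div, div_mul_eq_mul_div]
    refine div_le_div_of_nonneg_right ?_ hh.le
    linarith
  · rw [horb]
    have h1 : (segment P ρ (Real.exp (-Γ * 0))).PosDef := by
      rw [mul_zero, Real.exp_zero, segment_one]; exact hρ'
    have hmaps : Set.MapsTo (fun t => Real.exp (-Γ * t)) (Set.Ici 0)
        {s | (segment P ρ s).PosDef} := fun t ht => by
      rcases (Set.mem_Ici.mp ht).eq_or_lt with rfl | ht
      · exact h1
      · exact segment_posDef hρ.1 hM (Real.exp_pos _).le (hexp1 t ht)
    have hd := hasDerivWithinAt_segmentNegEntropy hP h1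
    have hcomp := HasDerivWithinAt.comp (h := fun t => Real.exp (-Γ * t)) (0 : ℝ) hd
      (hexp 0).hasDerivWithinAt hmaps
    exact (hcomp.sub_const _).differentiableWithinAt
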